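/- Let $n,k\in\mathbb{N}$, $\epsilon>0$ and $t\in\mathbb{R}$ be fixed. Write $\mathcal{S}^n_+$ for the cone of real symmetric positive semidefinite $n\times n$ matrices. For $X\in\mathcal{S}^n_+$ with eigenvalues $\lambda_1,\dots,\lambda_n$ and eigendecomposition $X=U\,\mathrm{Diag}(\lambda_1,\dots,\lambda_n)U^\top$ put $$\log\det\nolimits_\epsilon(X)=\sum_{i=1}^n\log(\lambda_i+\epsilon),\qquad \log_\epsilon(X)=U\,\mathrm{Diag}(\log(\lambda_1+\epsilon),\dots,\log(\lambda_n+\epsilon))U^\top .$$ For $Y\in\mathcal{S}^n_+$ let $Y^{1/2}$ be its positive semidefinite square root and $Y^{-1/2}$ the pseudoinverse of $Y^{1/2}$. Let $$\mathcal{S}=\{X\in\mathcal{S}^n_+:\ t\ge-\log\det\nolimits_\epsilon(X),\ \mathrm{Rank}(X)\le k\},$$ and let $\mathcal{S}^c$ be the set of all pairs $(Y,X)\in\mathcal{S}^n_+\times\mathcal{S}^n_+$ such that $0\preceq Y\preceq I$, $\mathrm{tr}(Y)\le k$, the columns of $X$ lie in the span of the columns of $Y$, and $$t\ \ge\ -\mathrm{tr}\big(Y^{1/2}\log_\epsilon(Y^{-1/2}XY^{-1/2})Y^{1/2}\big)-(n-\mathrm{tr}(Y))\log\epsilon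 .$$ Then $\mathcal{S}^c$ describes the convex hull of $\mathcal{S}$: a matrix $X$ lies in $\mathrm{Conv}(\mathcal{S})$ if and only if there is a matrix $Y$ with $(Y,X)\in\mathcal{S}^c$. The same equivalence holds if $Y$ is moreover required to commute with $X$. -/

import Mathlib

noncomputable section

namespace LowRankLogDet

open Matrix

/-- The pseudo log-determinant `∑ i, log (λ_i(X) + ε)` of a symmetric matrix `X`. -/
def logDetEps {n : ℕ} (ε : ℝ) {X : Matrix (Fin n) (Fin n) ℝ} (hX : X.IsHermitian) : ℝ :=
  ∑ i, Real.log (hX.eigenvalues i + ε)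

/-- The matrix `ε`-logarithm `U Diag(log (λ_i + ε)) Uᵀ` of a symmetric matrix
`W = U Diag(λ_i) Uᵀ`. -/
def logEps {n : ℕ} (ε : ℝ) (W : Matrix (Fin n) (Fin n) ℝ) : Matrix (Fin n) (Fin n) ℝ :=
  cfc (fun x : ℝ => Real.log (x + ε)) W

/-- The square root `Y^{1/2}` of a positive semidefinite matrix. -/
def sqrtMat {n : ℕ} (Y : Matrix (Fin n) (Fin n) ℝ) : Matrix (Fin n) (Fin n) ℝ :=
  cfc (fun x : ℝ => Real.sqrt x) Y

/-- `Y^{-1/2}`, the pseudoinverse of the square root of a positive semidefinite matrix: each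
eigenvalue `λ > 0` becomes `1 / √λ`, and the eigenvalue `0` is kept (here `0⁻¹ = 0`). -/
def pinvSqrtMat {n : ℕ} (Y : Matrix (Fin n) (Fin n) ℝ) : Matrix (Fin n) (Fin n) ℝ :=
  cfc (fun x : ℝ => (Real.sqrt x)⁻¹) Y

/-- The low-rank set `{X ⪰ 0 : t ≥ -log det_ε(X), rank X ≤ k}`. -/
def lowRankSet (n k : ℕ) (ε t : ℝ) : Set (Matrix (Fin n) (Fin n) ℝ) :=
  {X | ∃ hX : X.PosSemidef, t ≥ -logDetEps ε hX.isHermitian ∧ X.rank ≤ k}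

/-- The set of pairs `(Y, X)` of positive semidefinite matrices with `0 ⪯ Y ⪯ I`, `tr Y ≤ k` and
`t ≥ -tr (Y^{1/2} log_ε (Y^{-1/2} X Y^{-1/2}) Y^{1/2}) - (n - tr Y) log ε`. The inclusion of column
spaces is the condition under which the matrix perspective in this inequality is finite. -/
def perspectiveSet (n k : ℕ) (ε t : ℝ) :
    Set (Matrix (Fin n) (Fin n) ℝ × Matrix (Fin n) (Fin n) ℝ) :=
  {p | p.1.PosSemidef ∧ p.2.PosSemidef ∧ (1 - p.1).PosSemidef ∧ p.1.trace ≤ (k : ℝ) ∧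
    LinearMap.range p.2.mulVecLin ≤ LinearMap.range p.1.mulVecLin ∧
    t ≥ -(sqrtMat p.1 * logEps ε (pinvSqrtMat p.1 * p.2 * pinvSqrtMat p.1) * sqrtMat p.1).trace
        - ((n : ℝ) - p.1.trace) * Real.log ε}

end LowRankLogDet

end

noncomputable section

namespace LowRankLogDet

open Matrix Finset

/-! ### Scalar inequalities -/

/-! Both the hull and the relaxation are equivalent to one condition on the eigenvalues of `X`,
namely `Feasible`.

Necessity is Jensen: in an eigenbasis of `X`, either kind of membership writes the eigenvalues as
sums of common values `ω p` with nonnegative weights, and merging the weights of each eigenvalue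
does not decrease the concave perspective (`feasible_of_weights`). Feasible weights, placed on the
eigenvectors of `X`, give back a commuting `Y`.

For `Feasible` to imply hull membership when the rank exceeds `k`, the weights are replaced by the
optimal water-filling ones `min 1 (lam i / θ)`, of sum `k`. These average 0-1 vectors with `k` ones.
Each such vector selects `k` of the values `max (lam i) θ`; all fractional coordinates share the
value `θ`, so every selection has the same log-determinant, the optimal one. -/

lemma log_le_tangent {u v : ℝ} (hu : 0 < u) (hv : 0 < v) :
    Real.log u ≤ Real.log v + (u - v) / v := by
  have h := Real.log_le_sub_one_of_pos (div_pos hu hv)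
  rw [Real.log_div hu.ne' hv.ne'] at h
  rw [sub_div, div_self hv.ne']
  linarith

/-- Tangent bound for the perspective `y log (x / y + ε)` of the shifted logarithm. -/
lemma perspective_le_tangent {ε x y s : ℝ} (hε : 0 < ε) (hx : 0 ≤ x) (hy : 0 ≤ y) (hs : 0 ≤ s)
    (h0 : y = 0 → x = 0) :
    y * Real.log (x / y + ε) ≤ y * Real.log (s + ε) + (x - y * s) / (s + ε) := by
  rcases hy.eq_or_lt with rfl | hy'
  · simp [h0 rfl]
  · have h := mul_le_mul_of_nonneg_left
      (log_le_tangent (u := x / y + ε) (v := s + ε) (by positivity) (by positivity)) hy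
    refine h.trans (le_of_eq ?_)
    field_simp
    ring

/-- Jensen's inequality for the perspective of the shifted logarithm. -/
lemma sum_mul_log_le_perspective {ι : Type*} [Fintype ι] {ε : ℝ} (hε : 0 < ε) (a ω : ι → ℝ)
    (ha : ∀ p, 0 ≤ a p) (hω : ∀ p, 0 ≤ ω p) :
    ∑ p, a p * Real.log (ω p + ε) ≤
      (∑ p, a p) * Real.log ((∑ p, a p * ω p) / (∑ p, a p) + ε) := by
  have hA : 0 ≤ ∑ p, a p := sum_nonneg fun p _ => ha p
  have hB : 0 ≤ ∑ p, a p * ω p := sum_nonneg fun p _ => mul_nonneg (ha p) (hω p)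
  rcases hA.eq_or_lt with h | h
  · have h' : ∀ p, a p = 0 := fun p =>
      (sum_eq_zero_iff_of_nonneg fun p _ => ha p).1 h.symm p (mem_univ p)
    simp [h']
  · set s := (∑ p, a p * ω p) / (∑ p, a p) with hs
    have hs0 : 0 ≤ s := by positivity
    -- With the tangent taken at the weighted mean `s`, the linear terms cancel.
    have hsA : ∑ p, a p * (ω p - s) = 0 := by
      simp only [mul_sub, sum_sub_distrib, ← sum_mul]
      rw [hs]
      field_simp
      ring
    calc ∑ p, a p * Real.log (ω p + ε)
        ≤ ∑ p, (a p * Real.log (s + ε) + a p * (ω p - s) * (s + ε)⁻¹) := by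
          refine sum_le_sum fun p _ => ?_
          have h := mul_le_mul_of_nonneg_left (log_le_tangent (u := ω p + ε) (v := s + ε)
            (add_pos_of_nonneg_of_pos (hω p) hε) (by positivity)) (ha p)
          refine h.trans (le_of_eq ?_)
          rw [div_eq_mul_inv]
          ring
      _ = _ := by
          rw [sum_add_distrib, ← sum_mul, ← sum_mul, hsA]
          ring

/-- The derivative in `y` of the perspective `y (log (x / y + ε) - log ε)` at slope `s = x / y`. -/
def perspectiveSlope (ε s : ℝ) : ℝ := Real.log (s + ε) - Real.log ε - s / (s + ε)

/-- The tangent of `log` at `r + ε` shows that the logarithm grows by at least `(r - s) / (r + ε)`,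
and the subtracted fraction grows by at most that. -/
lemma perspectiveSlope_mono {ε s r : ℝ} (hε : 0 < ε) (hs : 0 ≤ s) (h : s ≤ r) :
    perspectiveSlope ε s ≤ perspectiveSlope ε r := by
  unfold perspectiveSlope
  have hr : 0 ≤ r := hs.trans h
  have h1 := log_le_tangent (u := s + ε) (v := r + ε) (by positivity) (by positivity)
  have h2 : r / (r + ε) - s / (s + ε) ≤ (r - s) / (r + ε) := by
    have : s / (r + ε) ≤ s / (s + ε) := by gcongr
    rw [sub_div]
    linarith
  have h3 : (s + ε - (r + ε)) / (r + ε) = -((r - s) / (r + ε)) := by ring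
  rw [h3] at h1
  linarith

lemma perspectiveSlope_nonneg {ε s : ℝ} (hε : 0 < ε) (hs : 0 ≤ s) : 0 ≤ perspectiveSlope ε s := by
  have := perspectiveSlope_mono hε le_rfl hs
  simpa [perspectiveSlope] using this

/-! ### Integrality of the hypersimplex -/

/-- Moving mass between two fractional coordinates `i` and `j`. -/
lemma shift_range {n : ℕ} {y : Fin n → ℝ} (hy : ∀ l, 0 ≤ y l ∧ y l ≤ 1) {i j : Fin n}
    (hij : i ≠ j) (hi : y i ≠ 0 ∧ y i ≠ 1) (hj : y j ≠ 0 ∧ y j ≠ 1) :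
    ∃ δ : ℝ, 0 < δ ∧ ∃ z : Fin n → ℝ, z = y + δ • (Pi.single i 1 - Pi.single j 1) ∧
      (∀ l, 0 ≤ z l ∧ z l ≤ 1) ∧ ∑ l, z l = ∑ l, y l ∧ (∀ l, y l = 1 → z l = 1) ∧
      #{l | z l ≠ 0 ∧ z l ≠ 1} < #{l | y l ≠ 0 ∧ y l ≠ 1} := by
  have hi0 : 0 < y i := lt_of_le_of_ne (hy i).1 (Ne.symm hi.1)
  have hj0 : 0 < y j := lt_of_le_of_ne (hy j).1 (Ne.symm hj.1)
  have hi1 : y i < 1 := lt_of_le_of_ne (hy i).2 hi.2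
  have hj1 : y j < 1 := lt_of_le_of_ne (hy j).2 hj.2
  -- The largest shift that stays in the cube: coordinate `i` reaches 1 or coordinate `j` reaches 0.
  refine ⟨min (1 - y i) (y j), lt_min (by linarith) hj0, _, rfl, ?_⟩
  set δ := min (1 - y i) (y j) with hδ
  have hδ1 : δ ≤ 1 - y i := min_le_left _ _
  have hδ2 : δ ≤ y j := min_le_right _ _
  have hδ0 : 0 < δ := lt_min (by linarith) hj0
  have zi : (y + δ • (Pi.single i 1 - Pi.single j 1) : Fin n → ℝ) i = y i + δ := by
    simp [hij]
  have zj : (y + δ • (Pi.single i 1 - Pi.single j 1) : Fin n → ℝ) j = y j - δ := by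
    simp [hij.symm, sub_eq_add_neg]
  have zl : ∀ l, l ≠ i → l ≠ j →
      (y + δ • (Pi.single i 1 - Pi.single j 1) : Fin n → ℝ) l = y l := by
    intro l h1 h2
    simp [h1, h2]
  have hsum : ∑ l, (y + δ • (Pi.single i 1 - Pi.single j 1) : Fin n → ℝ) l = ∑ l, y l := by
    simp only [Pi.add_apply, Pi.smul_apply, Pi.sub_apply, smul_eq_mul, sum_add_distrib,
      ← mul_sum, sum_sub_distrib, Finset.sum_pi_single', mem_univ, if_true]
    simp
  generalize (y + δ • (Pi.single i 1 - Pi.single j 1) : Fin n → ℝ) = z at *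
  refine ⟨fun l => ?_, hsum, fun l hl => ?_, card_lt_card ?_⟩
  · by_cases h1 : l = i
    · subst h1; rw [zi]; constructor <;> linarith
    by_cases h2 : l = j
    · subst h2; rw [zj]; constructor <;> linarith
    rw [zl l h1 h2]; exact hy l
  · rw [zl l (by rintro rfl; exact hi.2 hl) (by rintro rfl; exact hj.2 hl), hl]
  · refine (ssubset_iff_of_subset fun l hl => ?_).2 ?_
    · simp only [mem_filter, mem_univ, true_and] at hl ⊢
      by_cases h1 : l = i
      · subst h1; exact hi
      by_cases h2 : l = j
      · subst h2; exact hj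
      rwa [zl l h1 h2] at hl
    · rcases min_choice (1 - y i) (y j) with h | h
      · refine ⟨i, by simpa using hi, ?_⟩
        simp [zi, hδ, h]
      · refine ⟨j, by simpa using hj, ?_⟩
        simp [zj, hδ, h]

/-- A point of the hypersimplex is a convex combination of its `0`-`1` points that agree with it on
the coordinates where it is `1`. -/
lemma mem_convexHull_binary {n k : ℕ} (y₀ : Fin n → ℝ) (y : Fin n → ℝ)
    (hy : ∀ l, 0 ≤ y l ∧ y l ≤ 1) (hk : ∑ l, y l = k) (h1 : ∀ l, y₀ l = 1 → y l = 1) :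
    y ∈ convexHull ℝ {z : Fin n → ℝ | (∀ l, z l = 0 ∨ z l = 1) ∧ ∑ l, z l = k ∧
      ∀ l, y₀ l = 1 → z l = 1} := by
  induction hm : #{l | y l ≠ 0 ∧ y l ≠ 1} using Nat.strong_induction_on generalizing y with
  | _ m ih =>
  by_cases hfrac : ∃ i, y i ≠ 0 ∧ y i ≠ 1
  · obtain ⟨i, hi⟩ := hfrac
    -- A single fractional coordinate would put the integer `k` strictly between two consecutive
    -- integers.
    have hj : ∃ j, i ≠ j ∧ y j ≠ 0 ∧ y j ≠ 1 := by
      by_contra! hcon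
      have hrest : ∑ l ∈ univ.erase i, y l = (#{l ∈ univ.erase i | y l ≠ 0} : ℝ) := by
        rw [card_filter, Nat.cast_sum]
        refine sum_congr rfl fun l hl => ?_
        by_cases h0 : y l = 0
        · simp [h0]
        · simp [hcon l (ne_of_mem_erase hl).symm h0]
      have hsplit := add_sum_erase univ y (mem_univ i)
      rw [hrest, hk] at hsplit
      have hi0 : 0 < y i := lt_of_le_of_ne (hy i).1 (Ne.symm hi.1)
      have hi1 : y i < 1 := lt_of_le_of_ne (hy i).2 hi.2
      generalize #{l ∈ univ.erase i | y l ≠ 0} = c at hsplit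
      have hc1 : (c : ℝ) < k := by linarith
      have hc2 : (k : ℝ) < (c + 1 : ℕ) := by push_cast; linarith
      have hc1 := Nat.cast_lt.1 hc1
      have hc2 := Nat.cast_lt.1 hc2
      omega
    obtain ⟨j, hij, hj⟩ := hj
    obtain ⟨a, ha, u, hu, hu1, hu2, hu3, hu4⟩ := shift_range hy hij hi hj
    obtain ⟨b, hb, v, hv, hv1, hv2, hv3, hv4⟩ := shift_range hy hij.symm hj hi
    have hu' := ih _ (hm ▸ hu4) u hu1 (hu2.trans hk) (fun l hl => hu3 l (h1 l hl)) rfl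
    have hv' := ih _ (hm ▸ hv4) v hv1 (hv2.trans hk) (fun l hl => hv3 l (h1 l hl)) rfl
    -- The shifts by `a` and `b` are in opposite directions, so these weights cancel them.
    have hyc : y = (b / (a + b)) • u + (a / (a + b)) • v := by
      have hab : a + b ≠ 0 := by positivity
      ext l
      rw [hu, hv]
      simp only [Pi.add_apply, Pi.smul_apply, Pi.sub_apply, smul_eq_mul]
      field_simp
      ring
    rw [hyc]
    refine convex_convexHull ℝ _ hu' hv' (by positivity) (by positivity) ?_
    field_simp
    ring
  · push Not at hfrac
    refine subset_convexHull ℝ _ ⟨fun l => ?_, hk, h1⟩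
    by_cases h0 : y l = 0
    · exact Or.inl h0
    · exact Or.inr (hfrac l h0)

/-! ### The eigenvalue form of the relaxation -/

/-- The existence of weights `y` that certify `t` for the vector of eigenvalues `lam`. -/
def Feasible (n k : ℕ) (ε t : ℝ) (lam : Fin n → ℝ) : Prop :=
  ∃ y : Fin n → ℝ, (∀ i, 0 ≤ y i ∧ y i ≤ 1) ∧ ∑ i, y i ≤ k ∧ (∀ i, y i = 0 → lam i = 0) ∧
    -t ≤ ∑ i, y i * Real.log (lam i / y i + ε) + ((n : ℝ) - ∑ i, y i) * Real.log ε

/-- Feasibility from a decomposition of the eigenvalues along a common set of values `ω`. -/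
lemma feasible_of_weights {n k : ℕ} {ε t : ℝ} (hε : 0 < ε) {ι : Type*} [Fintype ι]
    (b : Fin n → ι → ℝ) (ω : ι → ℝ) (hb : ∀ i p, 0 ≤ b i p) (hω : ∀ p, 0 ≤ ω p)
    (hb1 : ∀ i, ∑ p, b i p ≤ 1) (hk : ∑ i, ∑ p, b i p ≤ k)
    (ht : -t ≤ ∑ i, ∑ p, b i p * Real.log (ω p + ε) +
      ((n : ℝ) - ∑ i, ∑ p, b i p) * Real.log ε) :
    Feasible n k ε t fun i => ∑ p, b i p * ω p := by
  refine ⟨fun i => ∑ p, b i p, fun i => ⟨sum_nonneg fun p _ => hb i p, hb1 i⟩, hk,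
    fun i hi => ?_, ht.trans ?_⟩
  · have h := (sum_eq_zero_iff_of_nonneg fun p _ => hb i p).1 hi
    exact sum_eq_zero fun p hp => by rw [h p hp, zero_mul]
  · gcongr with i
    exact sum_mul_log_le_perspective hε _ _ (hb i) hω

/-! ### Spectral decompositions -/

variable {n : ℕ}

lemma exists_eigendecomposition {M : Matrix (Fin n) (Fin n) ℝ} (hM : M.IsHermitian) :
    ∃ U : Matrix (Fin n) (Fin n) ℝ, Uᵀ * U = 1 ∧ U * Uᵀ = 1 ∧
      M = U * diagonal hM.eigenvalues * Uᵀ ∧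
      ∀ f : ℝ → ℝ, cfc f M = U * diagonal (fun i => f (hM.eigenvalues i)) * Uᵀ := by
  refine ⟨hM.eigenvectorUnitary, ?_, ?_, ?_, fun f => ?_⟩
  · simpa [star_eq_conjTranspose] using Unitary.coe_star_mul_self hM.eigenvectorUnitary
  · simpa [star_eq_conjTranspose] using Unitary.coe_mul_star_self hM.eigenvectorUnitary
  · simpa [Unitary.conjStarAlgAut_apply, star_eq_conjTranspose, Function.comp_def]
      using hM.spectral_theorem
  · rw [hM.cfc_eq, IsHermitian.cfc]
    simp [Unitary.conjStarAlgAut_apply, star_eq_conjTranspose, Function.comp_def]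

lemma isHermitian_conj_diagonal (U : Matrix (Fin n) (Fin n) ℝ) (d : Fin n → ℝ) :
    (U * diagonal d * Uᵀ).IsHermitian := by
  rw [IsHermitian, conjTranspose_eq_transpose_of_trivial]
  simp [transpose_mul, Matrix.mul_assoc]

lemma posSemidef_conj_diagonal (U : Matrix (Fin n) (Fin n) ℝ) {d : Fin n → ℝ}
    (hd : ∀ i, 0 ≤ d i) : (U * diagonal d * Uᵀ).PosSemidef := by
  have := (PosSemidef.diagonal (n := Fin n) (d := d) hd).mul_mul_conjTranspose_same U
  rwa [conjTranspose_eq_transpose_of_trivial] at this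

/-- Two diagonalisations are intertwined by `Vᵀ * U`, whose nonzero entries occur only where the
eigenvalues agree; it therefore intertwines their images under `f` too. -/
lemma cfc_conj_diagonal {U : Matrix (Fin n) (Fin n) ℝ} (hU : Uᵀ * U = 1) (hU' : U * Uᵀ = 1)
    (d : Fin n → ℝ) (f : ℝ → ℝ) :
    cfc f (U * diagonal d * Uᵀ) = U * diagonal (fun i => f (d i)) * Uᵀ := by
  obtain ⟨V, hV, hV', hM, hf⟩ := exists_eigendecomposition (isHermitian_conj_diagonal U d)
  rw [hf]
  generalize (isHermitian_conj_diagonal U d).eigenvalues = e at *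
  have h : diagonal e * (Vᵀ * U) = Vᵀ * U * diagonal d := by
    calc diagonal e * (Vᵀ * U) = (Vᵀ * V) * diagonal e * (Vᵀ * U) := by rw [hV, Matrix.one_mul]
      _ = Vᵀ * (V * diagonal e * Vᵀ) * U := by simp only [Matrix.mul_assoc]
      _ = Vᵀ * U * diagonal d * (Uᵀ * U) := by rw [← hM]; simp only [Matrix.mul_assoc]
      _ = _ := by rw [hU, Matrix.mul_one]
  have h' : diagonal (fun i => f (e i)) * (Vᵀ * U) =
      Vᵀ * U * diagonal (fun i => f (d i)) := by
    ext i j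
    have hij := congrFun (congrFun h i) j
    rw [diagonal_mul, mul_diagonal] at hij ⊢
    by_cases h0 : (Vᵀ * U) i j = 0
    · simp [h0]
    · have : e i = d j := mul_right_cancel₀ h0 (hij.trans (mul_comm _ _))
      rw [this, mul_comm]
  calc V * diagonal (fun i => f (e i)) * Vᵀ
      = V * diagonal (fun i => f (e i)) * Vᵀ * (U * Uᵀ) := by rw [hU', Matrix.mul_one]
    _ = V * (diagonal (fun i => f (e i)) * (Vᵀ * U)) * Uᵀ := by simp only [Matrix.mul_assoc]
    _ = (V * Vᵀ) * U * diagonal (fun i => f (d i)) * Uᵀ := by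
      rw [h']; simp only [Matrix.mul_assoc]
    _ = _ := by rw [hV', Matrix.one_mul]

lemma trace_conj_diagonal {U : Matrix (Fin n) (Fin n) ℝ} (hU : Uᵀ * U = 1) (d : Fin n → ℝ) :
    (U * diagonal d * Uᵀ).trace = ∑ i, d i := by
  rw [trace_mul_comm, ← Matrix.mul_assoc, hU, Matrix.one_mul, trace_diagonal]

lemma logDetEps_conj_diagonal {U : Matrix (Fin n) (Fin n) ℝ} (hU : Uᵀ * U = 1)
    (hU' : U * Uᵀ = 1) (d : Fin n → ℝ) (ε : ℝ) (h : (U * diagonal d * Uᵀ).IsHermitian) :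
    logDetEps ε h = ∑ i, Real.log (d i + ε) := by
  have h1 := congrArg trace (cfc_conj_diagonal hU hU' d fun x => Real.log (x + ε))
  obtain ⟨V, hV, -, -, hf⟩ := exists_eigendecomposition h
  rw [hf, trace_conj_diagonal hV, trace_conj_diagonal hU] at h1
  exact h1

lemma conj_diagonal_apply_diag (A : Matrix (Fin n) (Fin n) ℝ) (d : Fin n → ℝ) (i : Fin n) :
    (A * diagonal d * Aᵀ) i i = ∑ l, A i l ^ 2 * d l := by
  rw [mul_apply]
  refine sum_congr rfl fun l _ => ?_
  rw [mul_diagonal, transpose_apply]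
  ring

lemma sum_sq_row {A : Matrix (Fin n) (Fin n) ℝ} (hA : A * Aᵀ = 1) (i : Fin n) :
    ∑ l, A i l ^ 2 = 1 := by
  have h := congrFun (congrFun hA i) i
  rw [mul_apply, one_apply_eq] at h
  simpa [sq] using h

/-! ### The four inclusions -/

lemma feasible_of_mem_perspectiveSet {k : ℕ} {ε t : ℝ} (hε : 0 < ε)
    {X Y : Matrix (Fin n) (Fin n) ℝ} (h : (Y, X) ∈ perspectiveSet n k ε t) (hX : X.PosSemidef) :
    Feasible n k ε t hX.isHermitian.eigenvalues := by
  obtain ⟨hY, -, hY1, hk, hr, ht⟩ := h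
  dsimp only at hY hY1 hk hr ht
  have hYs : sqrtMat Y * sqrtMat Y = Y ∧ (sqrtMat Y)ᵀ = sqrtMat Y ∧
      (pinvSqrtMat Y)ᵀ = pinvSqrtMat Y ∧ sqrtMat Y * pinvSqrtMat Y * Y = Y := by
    obtain ⟨V, hV, hV', hM, hf⟩ := exists_eigendecomposition hY.isHermitian
    have he := hY.eigenvalues_nonneg
    simp only [sqrtMat, pinvSqrtMat, hf]
    generalize hY.isHermitian.eigenvalues = e at *
    have key : ∀ a b : Fin n → ℝ, V * diagonal a * Vᵀ * (V * diagonal b * Vᵀ) =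
        V * diagonal (fun i => a i * b i) * Vᵀ := fun a b => by
      calc _ = V * diagonal a * (Vᵀ * V) * diagonal b * Vᵀ := by simp only [Matrix.mul_assoc]
        _ = _ := by rw [hV, Matrix.mul_one, Matrix.mul_assoc V, diagonal_mul_diagonal]
    have tr : ∀ a : Fin n → ℝ, (V * diagonal a * Vᵀ)ᵀ = V * diagonal a * Vᵀ := fun a => by
      simp [transpose_mul, Matrix.mul_assoc]
    rw [hM]
    simp only [key, tr, true_and]
    refine ⟨?_, ?_⟩
    · congr 3; ext i; exact Real.mul_self_sqrt (he i)
    · congr 3; ext i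
      rcases (he i).eq_or_lt with h0 | h0
      · simp [← h0]
      · rw [mul_inv_cancel₀ (Real.sqrt_pos.2 h0).ne', one_mul]
  obtain ⟨hs, hsT, hpT, hproj⟩ := hYs
  have hW : (pinvSqrtMat Y * X * pinvSqrtMat Y).PosSemidef := by
    have := hX.mul_mul_conjTranspose_same (pinvSqrtMat Y)
    rwa [conjTranspose_eq_transpose_of_trivial, hpT] at this
  -- The product of the square root and its pseudoinverse fixes the range of `Y`, which contains the
  -- columns of `X`.
  have hPX : sqrtMat Y * pinvSqrtMat Y * X = X := by
    refine Matrix.ext_of_mulVec_single fun j => ?_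
    obtain ⟨v, hv⟩ := hr ⟨Pi.single j 1, rfl⟩
    rw [mulVecLin_apply, mulVecLin_apply] at hv
    rw [← mulVec_mulVec, ← hv, mulVec_mulVec, hproj]
  have hXT : Xᵀ = X := by simpa [conjTranspose_eq_transpose_of_trivial] using hX.isHermitian.eq
  have hXP : X * (pinvSqrtMat Y * sqrtMat Y) = X := by
    have := congrArg transpose hPX
    rwa [transpose_mul, hXT, transpose_mul, hsT, hpT] at this
  obtain ⟨V, hV, hV', hWV, hWf⟩ := exists_eigendecomposition hW.isHermitian
  have hω := hW.eigenvalues_nonneg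
  rw [logEps, hWf] at ht
  have hXW : X = sqrtMat Y * (pinvSqrtMat Y * X * pinvSqrtMat Y) * sqrtMat Y := by
    calc X = sqrtMat Y * pinvSqrtMat Y * X * (pinvSqrtMat Y * sqrtMat Y) := by rw [hPX, hXP]
      _ = _ := by simp only [Matrix.mul_assoc]
  generalize hW.isHermitian.eigenvalues = ω at *
  rw [hWV] at hXW
  obtain ⟨U, hU, hU', hXU, -⟩ := exists_eigendecomposition hX.isHermitian
  generalize hX.isHermitian.eigenvalues = lam at *
  -- The squared entries of `A` are the common weights: they give the diagonal of `Y` in the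
  -- eigenbasis of `X`, the eigenvalues of `X` against `ω`, and the trace term against the
  -- logarithms.
  set A := Uᵀ * (sqrtMat Y * V) with hA
  have hAT : Aᵀ = Vᵀ * sqrtMat Y * U := by rw [hA]; simp [transpose_mul, hsT]
  have hAA : ∀ d : Fin n → ℝ, A * diagonal d * Aᵀ =
      Uᵀ * (sqrtMat Y * (V * diagonal d * Vᵀ) * sqrtMat Y) * U := fun d => by
    rw [hAT, hA]; simp only [Matrix.mul_assoc]
  have hAY : A * diagonal (fun _ => 1) * Aᵀ = Uᵀ * Y * U := by
    rw [hAA, diagonal_one, Matrix.mul_one, hV', Matrix.mul_one, hs]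
  have hlam : A * diagonal ω * Aᵀ = diagonal lam := by
    rw [hAA, ← hXW]
    conv_lhs => rw [hXU]
    calc _ = (Uᵀ * U) * diagonal lam * (Uᵀ * U) := by simp only [Matrix.mul_assoc]
      _ = _ := by rw [hU, Matrix.one_mul, Matrix.mul_one]
  have htr : ∀ M : Matrix (Fin n) (Fin n) ℝ, (Uᵀ * M * U).trace = M.trace := fun M => by
    rw [trace_mul_comm, ← Matrix.mul_assoc, hU', Matrix.one_mul]
  have hy : ∀ i, ∑ l, A i l ^ 2 = (Uᵀ * Y * U) i i := fun i => by
    rw [← hAY, conj_diagonal_apply_diag]; simp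
  have hysum : ∑ i, ∑ l, A i l ^ 2 = Y.trace := by
    simp only [hy]
    exact htr Y
  have hlam' : lam = fun i => ∑ l, A i l ^ 2 * ω l := by
    ext i
    rw [← conj_diagonal_apply_diag, hlam, diagonal_apply_eq]
  rw [hlam']
  refine feasible_of_weights hε (fun i l => A i l ^ 2) ω (fun i l => sq_nonneg _) hω
    (fun i => ?_) (by rwa [hysum]) ?_
  · have h1 := hY1.conjTranspose_mul_mul_same U
    rw [conjTranspose_eq_transpose_of_trivial, Matrix.mul_sub, Matrix.sub_mul, Matrix.mul_one,
      hU] at h1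
    have h2 := h1.diag_nonneg (i := i)
    rw [Matrix.sub_apply, one_apply_eq] at h2
    rw [hy]
    linarith
  · have h1 : ∑ i, ∑ l, A i l ^ 2 * Real.log (ω l + ε) =
        (sqrtMat Y * (V * diagonal (fun l => Real.log (ω l + ε)) * Vᵀ) * sqrtMat Y).trace := by
      simp only [← conj_diagonal_apply_diag]
      rw [hAA]
      exact htr _
    rw [hysum, h1]
    linarith

lemma feasible_of_mem_convexHull {k : ℕ} {ε t : ℝ} (hε : 0 < ε)
    {X : Matrix (Fin n) (Fin n) ℝ} (h : X ∈ convexHull ℝ (lowRankSet n k ε t)) :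
    ∃ hX : X.PosSemidef, Feasible n k ε t hX.isHermitian.eigenvalues := by
  obtain ⟨ι, _, w, Z, hw0, hw1, hZ, hX⟩ := mem_convexHull_iff_exists_fintype.1 h
  choose hP hL hR using hZ
  have hXP : X.PosSemidef := hX ▸ posSemidef_sum _ fun j _ => (hP j).smul (hw0 j)
  refine ⟨hXP, ?_⟩
  obtain ⟨U, hU, hU', hXU, -⟩ := exists_eigendecomposition hXP.isHermitian
  generalize hXP.isHermitian.eigenvalues = lam at *
  choose V hV hV' hZV _ using fun j => exists_eigendecomposition (hP j).isHermitian
  set μ : ι → Fin n → ℝ := fun j => (hP j).isHermitian.eigenvalues with hμ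
  have hμ0 : ∀ j l, 0 ≤ μ j l := fun j => (hP j).eigenvalues_nonneg
  have hL' : ∀ j, -t ≤ ∑ l, Real.log (μ j l + ε) := fun j => by
    have := hL j
    rw [logDetEps] at this
    simp only [hμ]
    linarith
  have hR' : ∀ j, ∑ l, (if μ j l = 0 then (0 : ℝ) else 1) ≤ k := fun j => by
    have := hR j
    rw [(hP j).isHermitian.rank_eq_card_non_zero_eigs, Fintype.card_subtype, card_filter] at this
    have h' : ((∑ l, if μ j l ≠ 0 then 1 else 0 : ℕ) : ℝ) ≤ k := by exact_mod_cast this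
    push_cast at h'
    simpa [ite_not] using h'
  set A : ι → Matrix (Fin n) (Fin n) ℝ := fun j => Uᵀ * V j with hA
  have hAT : ∀ j, (A j)ᵀ = (V j)ᵀ * U := fun j => by simp [hA, transpose_mul]
  have hA1 : ∀ j, A j * (A j)ᵀ = 1 := fun j => by
    rw [hAT]
    calc _ = Uᵀ * (V j * (V j)ᵀ) * U := by simp only [hA, Matrix.mul_assoc]
      _ = _ := by rw [hV', Matrix.mul_one, hU]
  have hA2 : ∀ j, (A j)ᵀ * A j = 1 := fun j => by
    rw [hAT]
    calc _ = (V j)ᵀ * (U * Uᵀ) * V j := by simp only [hA, Matrix.mul_assoc]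
      _ = _ := by rw [hU', Matrix.mul_one, hV]
  have hcol : ∀ j l, ∑ i, A j i l ^ 2 = 1 := fun j l => by
    simpa using sum_sq_row (A := (A j)ᵀ) (by simpa using hA2 j) l
  -- Kernel directions of each `Z j` get weight 0, so the total weight is an average of ranks; their
  -- `log ε` terms are recovered from the slack `n - ∑ y`.
  set b : Fin n → ι × Fin n → ℝ :=
    fun i p => w p.1 * (A p.1 i p.2 ^ 2 * if μ p.1 p.2 = 0 then 0 else 1) with hb
  have hb0 : ∀ i p, 0 ≤ b i p := fun i p => by
    have := hw0 p.1
    simp only [hb]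
    positivity
  have hlam : lam = fun i => ∑ p, b i p * μ p.1 p.2 := by
    have hd : diagonal lam = ∑ j, w j • (A j * diagonal (μ j) * (A j)ᵀ) := by
      calc diagonal lam = (Uᵀ * U) * diagonal lam * (Uᵀ * U) := by
            rw [hU, Matrix.one_mul, Matrix.mul_one]
        _ = Uᵀ * X * U := by rw [hXU]; simp only [Matrix.mul_assoc]
        _ = ∑ j, w j • (Uᵀ * Z j * U) := by
            rw [← hX, Matrix.mul_sum, Matrix.sum_mul]
            simp
        _ = _ := by
            refine sum_congr rfl fun j _ => ?_
            rw [hAT]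
            conv_lhs => rw [hZV j]
            simp only [hA, Matrix.mul_assoc, hμ]
    ext i
    have := congrFun (congrFun hd i) i
    rw [diagonal_apply_eq, Matrix.sum_apply] at this
    rw [this, Fintype.sum_prod_type]
    refine sum_congr rfl fun j _ => ?_
    rw [Matrix.smul_apply, conj_diagonal_apply_diag, smul_eq_mul, mul_sum]
    refine sum_congr rfl fun l _ => ?_
    simp only [hb]
    by_cases h0 : μ j l = 0
    · simp [h0]
    · simp only [h0, if_false]; ring
  have hswap : ∀ g : ι → Fin n → ℝ, ∑ i, ∑ p, b i p * g p.1 p.2 =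
      ∑ j, w j * ∑ l, if μ j l = 0 then 0 else g j l := fun g => by
    rw [sum_comm, Fintype.sum_prod_type]
    refine sum_congr rfl fun j _ => ?_
    rw [mul_sum]
    refine sum_congr rfl fun l _ => ?_
    simp only [hb]
    rw [← sum_mul, ← mul_sum, ← sum_mul, hcol]
    split_ifs <;> simp
  have hysum : ∑ i, ∑ p, b i p = ∑ j, w j * ∑ l, if μ j l = 0 then 0 else 1 := by
    simpa using hswap fun _ _ => 1
  rw [hlam]
  refine feasible_of_weights hε b (fun p => μ p.1 p.2) hb0 (fun p => hμ0 _ _) (fun i => ?_) ?_ ?_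
  · calc ∑ p, b i p ≤ ∑ p : ι × Fin n, w p.1 * A p.1 i p.2 ^ 2 := by
          refine sum_le_sum fun p _ => ?_
          simp only [hb]
          refine mul_le_mul_of_nonneg_left (mul_le_of_le_one_right (sq_nonneg _) ?_) (hw0 _)
          split_ifs <;> norm_num
      _ = 1 := by
          rw [Fintype.sum_prod_type]
          simp only [← mul_sum, sum_sq_row (hA1 _), mul_one, hw1]
  · rw [hysum]
    calc _ ≤ ∑ j, w j * (k : ℝ) :=
          sum_le_sum fun j _ => mul_le_mul_of_nonneg_left (hR' j) (hw0 j)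
      _ = k := by rw [← sum_mul, hw1, one_mul]
  · rw [hysum, hswap fun j l => Real.log (μ j l + ε)]
    have hn : (n : ℝ) = ∑ j, w j * ∑ _l : Fin n, (1 : ℝ) := by
      simp [← sum_mul, hw1]
    calc -t = ∑ j, w j * -t := by rw [← sum_mul, hw1, one_mul]
      _ ≤ ∑ j, w j * ∑ l, Real.log (μ j l + ε) :=
          sum_le_sum fun j _ => mul_le_mul_of_nonneg_left (hL' j) (hw0 j)
      _ = _ := by
          rw [hn, ← sum_sub_distrib, sum_mul, ← sum_add_distrib]
          refine sum_congr rfl fun j _ => ?_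
          rw [← mul_sub, mul_assoc, ← mul_add, ← sum_sub_distrib, sum_mul, ← sum_add_distrib]
          congr 1
          refine sum_congr rfl fun l _ => ?_
          by_cases h0 : μ j l = 0 <;> simp [h0]

lemma exists_commuting_mem_perspectiveSet {k : ℕ} {ε t : ℝ}
    {X : Matrix (Fin n) (Fin n) ℝ} (hX : X.PosSemidef)
    (h : Feasible n k ε t hX.isHermitian.eigenvalues) :
    ∃ Y, (Y, X) ∈ perspectiveSet n k ε t ∧ Y * X = X * Y := by
  obtain ⟨y, hy, hk, h0, ht⟩ := h
  obtain ⟨U, hU, hU', hXU, -⟩ := exists_eigendecomposition hX.isHermitian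
  generalize hX.isHermitian.eigenvalues = lam at *
  have key : ∀ a b : Fin n → ℝ, U * diagonal a * Uᵀ * (U * diagonal b * Uᵀ) =
      U * diagonal (fun i => a i * b i) * Uᵀ := fun a b => by
    calc _ = U * diagonal a * (Uᵀ * U) * diagonal b * Uᵀ := by simp only [Matrix.mul_assoc]
      _ = _ := by rw [hU, Matrix.mul_one, Matrix.mul_assoc U, diagonal_mul_diagonal]
  refine ⟨U * diagonal y * Uᵀ, ⟨posSemidef_conj_diagonal U fun i => (hy i).1, hX, ?_, ?_, ?_, ?_⟩,
    ?_⟩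
  · have : (1 : Matrix (Fin n) (Fin n) ℝ) - U * diagonal y * Uᵀ =
        U * diagonal (fun i => 1 - y i) * Uᵀ := by
      rw [← diagonal_sub, diagonal_one, Matrix.mul_sub, Matrix.sub_mul, Matrix.mul_one, hU']
    dsimp only
    rw [this]
    exact posSemidef_conj_diagonal U fun i => sub_nonneg.2 (hy i).2
  · rwa [trace_conj_diagonal hU]
  · have hXY : X = U * diagonal y * Uᵀ * (U * diagonal (fun i => lam i / y i) * Uᵀ) := by
      rw [key, hXU]
      congr 3
      ext i
      by_cases hi : y i = 0
      · simp [hi, h0 i hi]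
      · field_simp
    rintro _ ⟨v, rfl⟩
    refine ⟨(U * diagonal (fun i => lam i / y i) * Uᵀ) *ᵥ v, ?_⟩
    simp only [mulVecLin_apply, mulVec_mulVec]
    rw [← hXY]
  · have hdiv : ∀ i, (Real.sqrt (y i))⁻¹ * lam i * (Real.sqrt (y i))⁻¹ = lam i / y i := fun i => by
      rw [mul_right_comm, ← mul_inv, Real.mul_self_sqrt (hy i).1, mul_comm, div_eq_mul_inv]
    have hsq : ∀ i (c : ℝ), Real.sqrt (y i) * c * Real.sqrt (y i) = y i * c := fun i c => by
      rw [mul_right_comm, Real.mul_self_sqrt (hy i).1]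
    dsimp only
    rw [sqrtMat, pinvSqrtMat, cfc_conj_diagonal hU hU', cfc_conj_diagonal hU hU', hXU, key, key,
      logEps, cfc_conj_diagonal hU hU', key, key, trace_conj_diagonal hU, trace_conj_diagonal hU]
    simp only [hdiv, hsq]
    linarith
  · rw [hXU, key, key]
    simp only [mul_comm]

lemma mem_lowRankSet_conj_diagonal {k : ℕ} {ε t : ℝ} {U : Matrix (Fin n) (Fin n) ℝ}
    (hU : Uᵀ * U = 1) (hU' : U * Uᵀ = 1) {d : Fin n → ℝ} (hd : ∀ i, 0 ≤ d i)
    (ht : -t ≤ ∑ i, Real.log (d i + ε)) (hk : #{i | d i ≠ 0} ≤ k) :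
    U * diagonal d * Uᵀ ∈ lowRankSet n k ε t := by
  refine ⟨posSemidef_conj_diagonal U hd, ?_, ?_⟩
  · rw [logDetEps_conj_diagonal hU hU']
    linarith
  · calc _ ≤ (U * diagonal d).rank := rank_mul_le_left _ _
      _ ≤ (diagonal d).rank := rank_mul_le_right _ _
      _ ≤ k := by rwa [rank_diagonal, Fintype.card_subtype]

/-- The supergradient inequality in the weight: comparison of the weight `y` with the weight `z`,
at which the argument `x / z` of the shifted logarithm is `s`. -/
lemma perspective_le_add_slope {ε x y z s : ℝ} (hε : 0 < ε) (hs : 0 ≤ s) (hx : x = z * s)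
    (hz : 0 ≤ z) (hy : 0 ≤ y) (h0 : y = 0 → x = 0) :
    y * Real.log (x / y + ε) + (1 - y) * Real.log ε ≤
      z * Real.log (s + ε) + (1 - z) * Real.log ε + (y - z) * perspectiveSlope ε s := by
  have h := perspective_le_tangent hε (hx ▸ mul_nonneg hz hs) hy hs h0
  have h2 : (x - y * s) / (s + ε) = (z - y) * (s / (s + ε)) := by rw [hx]; ring
  rw [h2] at h
  unfold perspectiveSlope
  linarith

/-- The water-filling level: the capped multiples `min 1 (lam i / θ)` can be made to sum to `k`. -/
lemma exists_level {k : ℕ} {lam : Fin n → ℝ} (hlam : ∀ i, 0 ≤ lam i) (hk0 : 0 < k)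
    (hk : k < #{i | lam i ≠ 0}) :
    ∃ θ : ℝ, 0 < θ ∧ ∑ i, min 1 (lam i / θ) = k := by
  set F : ℝ → ℝ := fun s => ∑ i, min 1 (lam i * s) with hF
  have hFc : Continuous F := by fun_prop
  have hF0 : F 0 = 0 := by simp [hF]
  -- At this scale every nonzero `lam i * s₁` is at least 1, so `F s₁` is at least the rank.
  set s₁ := ∑ i, (lam i)⁻¹ with hs₁
  have hinv : ∀ i ∈ univ, 0 ≤ (lam i)⁻¹ := fun i _ => inv_nonneg.2 (hlam i)
  have hs0 : 0 ≤ s₁ := sum_nonneg hinv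
  have hF1 : (k : ℝ) ≤ F s₁ := by
    have h1 : (#{i | lam i ≠ 0} : ℝ) ≤ F s₁ := by
      rw [card_filter, Nat.cast_sum]
      refine sum_le_sum fun i hi => ?_
      by_cases h0 : lam i = 0
      · simp [h0]
      · have : lam i * (lam i)⁻¹ ≤ lam i * s₁ :=
          mul_le_mul_of_nonneg_left (single_le_sum hinv hi) (hlam i)
        rw [mul_inv_cancel₀ h0] at this
        simp [h0, this]
    exact (Nat.cast_le.2 hk.le).trans h1
  obtain ⟨s, hs, hsk⟩ := intermediate_value_Icc hs0 hFc.continuousOn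
    (show (k : ℝ) ∈ Set.Icc (F 0) (F s₁) from ⟨by rw [hF0]; positivity, hF1⟩)
  have hs' : 0 < s := by
    refine lt_of_le_of_ne hs.1 ?_
    rintro rfl
    rw [hF0] at hsk
    exact hk0.ne (by exact_mod_cast hsk)
  exact ⟨s⁻¹, inv_pos.2 hs', by simpa [hF, div_inv_eq_mul] using hsk⟩

lemma mem_convexHull_of_feasible {k : ℕ} {ε t : ℝ} (hε : 0 < ε)
    {X : Matrix (Fin n) (Fin n) ℝ} (hX : X.PosSemidef)
    (h : Feasible n k ε t hX.isHermitian.eigenvalues) :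
    X ∈ convexHull ℝ (lowRankSet n k ε t) := by
  obtain ⟨y, hy, hk, h0, ht⟩ := h
  have hlam := hX.eigenvalues_nonneg
  obtain ⟨U, hU, hU', hXU, -⟩ := exists_eigendecomposition hX.isHermitian
  generalize hX.isHermitian.eigenvalues = lam at *
  have ht' : -t ≤ ∑ i, (y i * Real.log (lam i / y i + ε) + (1 - y i) * Real.log ε) := by
    rw [sum_add_distrib, ← sum_mul, sum_sub_distrib]
    simpa using ht
  rcases le_or_gt (#{i | lam i ≠ 0}) k with hr | hr
  · rw [hXU]
    refine subset_convexHull ℝ _ (mem_lowRankSet_conj_diagonal hU hU' hlam (ht'.trans ?_) hr)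
    -- The slope is nonnegative, so raising every weight to 1 loses nothing.
    refine sum_le_sum fun i _ => ?_
    have h1 := perspective_le_add_slope (z := 1) hε (hlam i) (one_mul _).symm zero_le_one
      (hy i).1 (h0 i)
    have h2 := mul_nonneg (sub_nonneg.2 (hy i).2) (perspectiveSlope_nonneg hε (hlam i))
    linarith
  have hk0 : 0 < k := by
    rcases Nat.eq_zero_or_pos k with rfl | hk0
    · rw [Nat.cast_zero] at hk
      have hy0 := (sum_eq_zero_iff_of_nonneg fun i _ => (hy i).1).1
        (le_antisymm hk (sum_nonneg fun i _ => (hy i).1))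
      simp [fun i => h0 i (hy0 i (mem_univ i))] at hr
    · exact hk0
  obtain ⟨θ, hθ, hsum⟩ := exists_level hlam hk0 hr
  set x : Fin n → ℝ := fun i => min 1 (lam i / θ) with hx
  set s : Fin n → ℝ := fun i => max (lam i) θ with hs
  have hs0 : ∀ i, 0 < s i := fun i => lt_max_of_lt_right hθ
  have hx01 : ∀ i, 0 ≤ x i ∧ x i ≤ 1 := fun i =>
    ⟨le_min zero_le_one (div_nonneg (hlam i) hθ.le), min_le_left _ _⟩
  have hcase : ∀ i, x i = 1 ∧ s i = lam i ∨ x i = lam i / θ ∧ s i = θ := fun i => by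
    rcases le_total (lam i) θ with h | h
    · exact Or.inr ⟨min_eq_right ((div_le_one hθ).2 h), max_eq_right h⟩
    · exact Or.inl ⟨min_eq_left ((one_le_div hθ).2 h), max_eq_left h⟩
  have hxs : ∀ i, lam i = x i * s i := fun i => by
    rcases hcase i with h | h
    · rw [h.1, h.2, one_mul]
    · rw [h.1, h.2, div_mul_cancel₀ _ hθ.ne']
  -- The slope at `θ` acts as the Lagrange multiplier of the budget `k`: uncapped coordinates have
  -- exactly this slope, and capped ones have at least it while `y i - x i ≤ 0`.
  have hopt : -t ≤ ∑ i, (x i * Real.log (s i + ε) + (1 - x i) * Real.log ε) := by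
    have hle : ∀ i, y i * Real.log (lam i / y i + ε) + (1 - y i) * Real.log ε ≤
        x i * Real.log (s i + ε) + (1 - x i) * Real.log ε +
          (y i - x i) * perspectiveSlope ε θ := fun i => by
      refine (perspective_le_add_slope hε (hs0 i).le (hxs i) (hx01 i).1 (hy i).1 (h0 i)).trans ?_
      refine add_le_add le_rfl ?_
      rcases hcase i with h | h
      · refine mul_le_mul_of_nonpos_left
          (perspectiveSlope_mono hε hθ.le (le_max_right _ _)) ?_
        rw [h.1]
        exact sub_nonpos.2 (hy i).2
      · rw [h.2]
    have h1 := ht'.trans (sum_le_sum fun i _ => hle i)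
    rw [sum_add_distrib, ← sum_mul, sum_sub_distrib, hsum] at h1
    have h2 := mul_nonneg (sub_nonneg.2 hk) (perspectiveSlope_nonneg hε hθ.le)
    linarith
  let L : (Fin n → ℝ) →ₗ[ℝ] Matrix (Fin n) (Fin n) ℝ :=
    { toFun := fun z => U * diagonal (fun i => z i * s i) * Uᵀ
      map_add' := fun a b => by
        simp only [Pi.add_apply, add_mul]
        rw [← diagonal_add, Matrix.mul_add, Matrix.add_mul]
      map_smul' := fun c a => by
        have : (fun i => (c • a) i * s i) = c • fun i => a i * s i := by
          ext i; simp [mul_assoc]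
        rw [this, diagonal_smul, Matrix.mul_smul, Matrix.smul_mul, RingHom.id_apply] }
  have hmem := Set.mem_image_of_mem L
    (mem_convexHull_binary (k := k) x x hx01 hsum fun _ h => h)
  rw [L.image_convexHull] at hmem
  have hLx : L x = X := by
    rw [hXU]
    exact congrArg (fun d => U * diagonal d * Uᵀ) (funext fun i => (hxs i).symm)
  rw [hLx] at hmem
  refine convexHull_mono ?_ hmem
  rintro _ ⟨z, ⟨hz, hzk, hz1⟩, rfl⟩
  have hz0 : ∀ i, 0 ≤ z i := fun i => by rcases hz i with h | h <;> simp [h]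
  refine mem_lowRankSet_conj_diagonal hU hU' (fun i => mul_nonneg (hz0 i) (hs0 i).le)
    (hopt.trans (le_of_eq ?_)) ?_
  -- Since `z` agrees with `x` on capped coordinates, the change from `x` to `z` enters with one
  -- constant factor, and equal sums make it vanish.
  · have hterm : ∀ i, Real.log (z i * s i + ε) =
        x i * Real.log (s i + ε) + (1 - x i) * Real.log ε +
          (z i - x i) * (Real.log (θ + ε) - Real.log ε) := fun i => by
      have h1 : Real.log (z i * s i + ε) =
          z i * Real.log (s i + ε) + (1 - z i) * Real.log ε := by
        rcases hz i with h | h <;> simp [h]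
      rw [h1]
      rcases hcase i with h | h
      · rw [h.1, hz1 i h.1]
        ring
      · rw [h.2]
        ring
    have hzx : ∑ i, (z i - x i) * (Real.log (θ + ε) - Real.log ε) = 0 := by
      rw [← sum_mul, sum_sub_distrib, hzk, hsum, sub_self, zero_mul]
    simp only [hterm]
    rw [sum_add_distrib (g := fun i => (z i - x i) * _), hzx, add_zero]
  · have hc : (#{i | z i * s i ≠ 0} : ℝ) = k := by
      rw [← hzk, card_filter, Nat.cast_sum]
      refine sum_congr rfl fun i _ => ?_
      rcases hz i with h | h <;> simp [h, (hs0 i).ne']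
    exact (Nat.cast_injective hc).le

end LowRankLogDet

end

theorem corollary2 (n k : ℕ) (ε t : ℝ) (hε : 0 < ε) :
    convexHull ℝ (LowRankLogDet.lowRankSet n k ε t) =
        {X | ∃ Y, (Y, X) ∈ LowRankLogDet.perspectiveSet n k ε t} ∧
      convexHull ℝ (LowRankLogDet.lowRankSet n k ε t) =
        {X | ∃ Y, (Y, X) ∈ LowRankLogDet.perspectiveSet n k ε t ∧ Y * X = X * Y} := by
  have hcomm : convexHull ℝ (LowRankLogDet.lowRankSet n k ε t) ⊆
      {X | ∃ Y, (Y, X) ∈ LowRankLogDet.perspectiveSet n k ε t ∧ Y * X = X * Y} := fun X hX => by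
    obtain ⟨hP, hF⟩ := LowRankLogDet.feasible_of_mem_convexHull hε hX
    exact LowRankLogDet.exists_commuting_mem_perspectiveSet hP hF
  have hconv : {X | ∃ Y, (Y, X) ∈ LowRankLogDet.perspectiveSet n k ε t} ⊆
      convexHull ℝ (LowRankLogDet.lowRankSet n k ε t) := by
    rintro X ⟨Y, hY⟩
    exact LowRankLogDet.mem_convexHull_of_feasible hε hY.2.1
      (LowRankLogDet.feasible_of_mem_perspectiveSet hε hY hY.2.1)
  exact ⟨Set.Subset.antisymm (fun X hX => (hcomm hX).imp fun _ h => h.1) hconv,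
    Set.Subset.antisymm hcomm fun X hX => hconv (hX.imp fun _ h => h.1)⟩
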